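/- A continuum is a compact connected (nonempty) metric space, a subcontinuum of a space is a nonempty compact connected subset, and a subcontinuum is proper if it is not the whole space. A continuum $X$ is chainable if for every $\varepsilon>0$ it has a finite open cover $\{U_1,\dots,U_n\}$ with $\operatorname{diam}(U_j)<\varepsilon$ for all $j$ and such that $U_j\cap U_k\neq\emptyset$ if and only if $|j-k|\le 1$. It is hereditarily indecomposable if no subcontinuum of $X$ is the union of two subcontinua that are both properly contained in it. The pseudo-arc is a nondegenerate (that is, having more than one point) hereditarily indecomposable chainable continuum. For a continuum $Z$ and $A\subseteq Z$ let $$\mathcal{T}_Z(A)=Z\setminus\{z\in Z : \text{there is a subcontinuum } W \text{ of } Z \text{ with } z\in \operatorname{Int}(W)\subseteq W\subseteq Z\setminus A\};$$ a nonempty closed subset $A$ of $Z$ is $\mathcal{T}$-closed if $\mathcal{T}_Z(A)=A$. Theorem. Let $X$ be the pseudo-arc, and let $C$ be a subcontinuum of $X^2=X\times X$ that is $\mathcal{T}$-closed, i.e. $\mathcal{T}_{X^2}(C)=C$. Then either (1) $C=X^2$, or (2) $C=A\times B$, where $A$ and $B$ are proper subcontinua of $X$. -/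

import Mathlib

namespace ContinuumTheory

/-- A subcontinuum of `Z`: a nonempty, compact, connected subset (`IsConnected` includes
nonemptiness). -/
def IsSubcontinuum {Z : Type*} [TopologicalSpace Z] (A : Set Z) : Prop :=
  IsCompact A ∧ IsConnected A

/-- A proper subcontinuum of the space `Z`: one that is not the whole space. -/
def IsProperSubcontinuum {Z : Type*} [TopologicalSpace Z] (A : Set Z) : Prop :=
  IsSubcontinuum A ∧ A ≠ Set.univ

/-- The subcontinuum `K` is decomposable: it is the union of two subcontinua, each of them a
proper subset of `K`. -/
def IsDecomposable {Z : Type*} [TopologicalSpace Z] (K : Set Z) : Prop :=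
  ∃ A B : Set Z, IsSubcontinuum A ∧ IsSubcontinuum B ∧ A ⊂ K ∧ B ⊂ K ∧ K = A ∪ B

/-- Every subcontinuum of `Z` is indecomposable. -/
def IsHereditarilyIndecomposable (Z : Type*) [TopologicalSpace Z] : Prop :=
  ∀ K : Set Z, IsSubcontinuum K → ¬ IsDecomposable K

/-- Chainability (used for compact metric spaces, where all diameters are finite): for every
`ε > 0` there is a finite open cover `U 0, …, U (n - 1)` by sets of diameter less than `ε` such that
`U j` meets `U k` if and only if `|j - k| ≤ 1`. -/
def IsChainable (Z : Type*) [MetricSpace Z] : Prop :=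
  ∀ ε : ℝ, 0 < ε → ∃ (n : ℕ) (U : Fin n → Set Z),
    (∀ j, IsOpen (U j)) ∧ (⋃ j, U j) = Set.univ ∧
    (∀ j k, (U j ∩ U k).Nonempty ↔ |((j : ℕ) : ℤ) - ((k : ℕ) : ℤ)| ≤ 1) ∧
    ∀ j, Metric.diam (U j) < ε

/-- A pseudo-arc: a nondegenerate hereditarily indecomposable chainable continuum, a continuum
being a compact, connected metric space (`ConnectedSpace` includes nonemptiness). -/
structure IsPseudoArc (X : Type*) [MetricSpace X] : Prop where
  compact : CompactSpace X
  connected : ConnectedSpace X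
  nondegenerate : Nontrivial X
  hereditarilyIndecomposable : IsHereditarilyIndecomposable X
  chainable : IsChainable X

/-- Jones' set function `𝒯`: a point is removed from the space if and only if it is interior to some
subcontinuum `W` that misses `A`. -/
def jonesT {Z : Type*} [TopologicalSpace Z] (A : Set Z) : Set Z :=
  {x | ∃ W : Set Z, IsSubcontinuum W ∧ x ∈ interior W ∧ W ⊆ Aᶜ}ᶜ

/-- A `𝒯`-closed set: a nonempty closed set `A` with `𝒯(A) = A`. -/
def IsTClosed {Z : Type*} [TopologicalSpace Z] (A : Set Z) : Prop :=
  A.Nonempty ∧ IsClosed A ∧ jonesT A = A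

end ContinuumTheory

/-! In the square of a chainable continuum, a continuum spanning another horizontally must meet it
if it is itself spanned vertically (`IsChainable.inter_nonempty`). Link indices of a fine chain turn
this into a crossing statement in the integer lattice, proved with a winding-type invariant.
Subcontinua of a hereditarily indecomposable space are nested or disjoint, and by boundary bumping a
proper one has empty interior. So any continuum `W` with interior in the square projects onto both
factors. If `C` omits a point, such a `W` misses `C`, and the crossing result forbids either
projection `A`, `B` of `C` to be the whole of `X`. If `C` omits a point `p` of `A ×ˢ B`, then `W`
around `p` leaves `A ×ˢ B`, yet contains a continuum inside `A ×ˢ B` projecting onto `A` or `B`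
(`exists_subcontinuum_prod`); that continuum must cross `C`, a contradiction. -/

namespace ContinuumTheory

open Set

/-! ### Crossing numbers of lattice paths -/

section CrossingNumber

/-- The indicator of the point `w` lying strictly to the right of the abscissa `x`. -/
def rightOf (x : ℤ) (w : ℤ × ℤ) : ℤ := if x < w.1 then 1 else 0

/-- The indicator of the point `w` lying at or below the ordinate `y`. -/
def atMost (y : ℤ) (w : ℤ × ℤ) : ℤ := if w.2 ≤ y then 1 else 0

/-- The signed number of times the lattice path `q 0, …, q l`, prolonged vertically to infinity at
both ends, crosses the rightward horizontal ray that starts just above the lattice point `v`. -/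
def crossingNumber (q : ℕ → ℤ × ℤ) (l : ℕ) (v : ℤ × ℤ) : ℤ :=
  rightOf v.1 (q 0) +
    ∑ t ∈ Finset.range l, atMost v.2 (q (t + 1)) * (rightOf v.1 (q (t + 1)) - rightOf v.1 (q t))

/-- Two lattice points at distance at most `d` in the sup metric. -/
def Near (d : ℤ) (v w : ℤ × ℤ) : Prop := |v.1 - w.1| ≤ d ∧ |v.2 - w.2| ≤ d

/-- Summation by parts. The definition counts crossings of the downward vertical ray, which suits
vertical moves of `v`; this form counts crossings of the horizontal ray and suits horizontal moves.
A diagonal step is read as vertical, then horizontal, in both. -/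
theorem crossingNumber_eq (q : ℕ → ℤ × ℤ) (l : ℕ) (v : ℤ × ℤ) :
    crossingNumber q l v =
      (1 - atMost v.2 (q 0)) * rightOf v.1 (q 0) + atMost v.2 (q l) * rightOf v.1 (q l) +
        ∑ t ∈ Finset.range l, (atMost v.2 (q t) - atMost v.2 (q (t + 1))) * rightOf v.1 (q t) := by
  unfold crossingNumber
  induction l with
  | zero => simp; ring
  | succ l ih =>
    rw [Finset.sum_range_succ, Finset.sum_range_succ]
    linear_combination ih

variable {q : ℕ → ℤ × ℤ} {l : ℕ} {v w : ℤ × ℤ}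

/-- `crossingNumber` only sees those values of `rightOf` that belong to points of the path near the
level of `v`, or to an end of the path on the appropriate side. -/
theorem crossingNumber_congr (hq : ∀ t < l, Near 1 (q t) (q (t + 1)))
    (h0 : (q 0).2 ≤ v.2) (hl : v.2 ≤ (q l).2) (hvw : v.2 = w.2)
    (h : ∀ t ≤ l, |(q t).2 - v.2| ≤ 1 → rightOf v.1 (q t) = rightOf w.1 (q t)) :
    crossingNumber q l v = crossingNumber q l w := by
  rw [crossingNumber_eq, crossingNumber_eq, ← hvw]
  have e0 : (1 - atMost v.2 (q 0)) * rightOf v.1 (q 0) =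
      (1 - atMost v.2 (q 0)) * rightOf w.1 (q 0) := by
    simp [atMost, h0]
  have el : atMost v.2 (q l) * rightOf v.1 (q l) = atMost v.2 (q l) * rightOf w.1 (q l) := by
    by_cases hle : (q l).2 ≤ v.2
    · rw [h l le_rfl (by rw [le_antisymm hle hl]; simp)]
    · simp [atMost, hle]
  rw [e0, el]
  congr 1
  refine Finset.sum_congr rfl fun t ht => ?_
  have ht := Finset.mem_range.1 ht
  by_cases hn : |(q t).2 - v.2| ≤ 1
  · rw [h t ht.le hn]
  · have := (hq t ht).2
    have : atMost v.2 (q t) = atMost v.2 (q (t + 1)) := by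
      unfold atMost
      split_ifs <;> grind
    simp [this]

/-- A summand can change only if `q (t + 1)` is within one level of `v` and the step switches sides
of the abscissa of `v`; this would put `q (t + 1)` near `v`. -/
theorem crossingNumber_vertical (hq : ∀ t < l, Near 1 (q t) (q (t + 1)))
    (hx : v.1 = w.1) (hy : |v.2 - w.2| ≤ 1) (hfar : ∀ t ≤ l, ¬ Near 1 (q t) v) :
    crossingNumber q l v = crossingNumber q l w := by
  unfold crossingNumber
  rw [← hx]
  congr 1
  refine Finset.sum_congr rfl fun t ht => ?_
  have ht := Finset.mem_range.1 ht
  have h1 := (hq t ht).1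
  have h2 := hfar (t + 1) ht
  unfold Near at h2
  unfold atMost rightOf
  split_ifs <;> grind

theorem crossingNumber_eq_of_near (hq : ∀ t < l, Near 1 (q t) (q (t + 1)))
    (h0 : (q 0).2 ≤ v.2) (hl : v.2 ≤ (q l).2) (hvw : Near 1 v w)
    (hfar : ∀ t ≤ l, ¬ Near 2 (q t) v) :
    crossingNumber q l v = crossingNumber q l w := by
  obtain ⟨h1, h2⟩ := hvw
  -- Move horizontally, then vertically; the distance 2 in `hfar` leaves distance 1 at the corner.
  trans crossingNumber q l (w.1, v.2)
  · refine crossingNumber_congr hq h0 hl rfl fun t ht hn => ?_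
    have := hfar t ht
    unfold Near at this
    unfold rightOf
    split_ifs <;> grind
  · refine crossingNumber_vertical hq rfl h2 fun t ht hn => hfar t ht ?_
    unfold Near at hn ⊢
    grind

theorem crossingNumber_of_le (hq : ∀ t < l, Near 1 (q t) (q (t + 1)))
    (h0 : (q 0).2 ≤ v.2) (hl : v.2 ≤ (q l).2) (hle : ∀ t ≤ l, v.1 ≤ (q t).1)
    (hfar : ∀ t ≤ l, ¬ Near 2 (q t) v) : crossingNumber q l v = 1 := by
  -- `rightOf` is strict, so `v` is shifted left to have the whole path strictly on its right.
  obtain ⟨x, hx⟩ : ∃ x : ℤ, ∀ t ∈ Finset.range (l + 1), x < (q t).1 := by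
    refine ⟨v.1 - 1, fun t ht => ?_⟩
    have := hle t (by grind)
    omega
  rw [crossingNumber_congr (w := (x, v.2)) hq h0 hl rfl]
  · unfold crossingNumber rightOf
    rw [Finset.sum_eq_zero]
    · simp [hx 0 (by simp)]
    · intro t ht
      rw [if_pos (hx _ (by grind)), if_pos (hx _ (by grind))]
      simp
  · intro t ht hn
    have := hle t ht
    have := hfar t ht
    have := hx t (by grind)
    unfold Near at *
    unfold rightOf
    split_ifs <;> grind

theorem crossingNumber_of_ge (hle : ∀ t ≤ l, (q t).1 ≤ v.1) : crossingNumber q l v = 0 := by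
  unfold crossingNumber rightOf
  rw [Finset.sum_eq_zero]
  · simp [hle 0 (by simp)]
  · intro t ht
    have h1 := hle t (by grind)
    have h2 := hle (t + 1) (by grind)
    rw [if_neg (by omega), if_neg (by omega)]
    simp

end CrossingNumber

/-! ### Discrete crossing of connected sets -/

section Connected

variable {Z : Type*} [TopologicalSpace Z]

/-- A function with near values at nearby points has its values on a connected set joined by a
lattice path with near steps. -/
theorem exists_path_of_isPreconnected {D : Set Z} (hD : IsPreconnected D) (f : Z → ℤ × ℤ)
    (hf : ∀ x, ∀ᶠ y in nhds x, Near 1 (f x) (f y)) {x y : Z} (hx : x ∈ D) (hy : y ∈ D) :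
    ∃ (l : ℕ) (q : ℕ → ℤ × ℤ), q 0 = f x ∧ q l = f y ∧ (∀ t ≤ l, q t ∈ f '' D) ∧
      ∀ t < l, Near 1 (q t) (q (t + 1)) := by
  have key : Relation.ReflTransGen (fun u v => u ∈ D ∧ v ∈ D ∧ Near 1 (f u) (f v)) x y := by
    refine hD.induction₂' _ (fun u hu => ?_) ?_ hx hy
    · filter_upwards [mem_nhdsWithin_of_mem_nhds (hf u), self_mem_nhdsWithin] with v hv hvD
      refine ⟨.single ⟨hu, hvD, hv⟩, .single ⟨hvD, hu, ?_⟩⟩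
      unfold Near at *
      grind
    · intro a b c _ _ _ hab hbc
      exact hab.trans hbc
  induction key with
  | refl => exact ⟨0, fun _ => f x, rfl, rfl, fun _ _ => ⟨x, hx, rfl⟩, by simp⟩
  | tail _ hbc ih =>
    rename_i b c _
    obtain ⟨l, q, h0, hl, hm, hn⟩ := ih hbc.1
    refine ⟨l + 1, fun t => if t ≤ l then q t else f c, by simp [h0], by simp, fun t ht => ?_,
      fun t ht => ?_⟩
    · by_cases h : t ≤ l
      · simpa [h] using hm t h
      · simpa [h] using ⟨c, hbc.2.1, rfl⟩
    · rcases Nat.lt_succ_iff_lt_or_eq.1 ht with h | rfl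
      · simpa [h.le, Nat.succ_le_of_lt h] using hn t h
      · simpa [hl] using hbc.2.2

theorem eq_of_isPreconnected {Y : Type*} {K : Set Z} (hK : IsPreconnected K) (r : Z → Y)
    (hr : ∀ x ∈ K, ∀ᶠ y in nhds x, y ∈ K → r x = r y) {x y : Z} (hx : x ∈ K) (hy : y ∈ K) :
    r x = r y := by
  refine hK.induction₂' (fun a b => r a = r b) (fun u hu => ?_) ?_ hx hy
  · filter_upwards [mem_nhdsWithin_of_mem_nhds (hr u hu), self_mem_nhdsWithin] with v hv hvK
    exact ⟨hv hvK, (hv hvK).symm⟩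
  · intro a b c _ _ _ h1 h2
    exact h1.trans h2

/-- Discrete crossing theorem: if a connected set `K` spans the abscissas of a connected set `D`,
and `D` spans the ordinates of `K`, then `f` takes near values somewhere on `K` and `D`. -/
theorem exists_near_of_spans {K D : Set Z} (hK : IsPreconnected K) (hD : IsPreconnected D)
    (f : Z → ℤ × ℤ) (hf : ∀ x, ∀ᶠ y in nhds x, Near 1 (f x) (f y))
    {k₀ k₁ d₀ d₁ : Z} (hk₀ : k₀ ∈ K) (hk₁ : k₁ ∈ K) (hd₀ : d₀ ∈ D) (hd₁ : d₁ ∈ D)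
    (h₀ : ∀ d ∈ D, (f k₀).1 ≤ (f d).1) (h₁ : ∀ d ∈ D, (f d).1 ≤ (f k₁).1)
    (h₂ : ∀ k ∈ K, (f d₀).2 ≤ (f k).2) (h₃ : ∀ k ∈ K, (f k).2 ≤ (f d₁).2) :
    ∃ k ∈ K, ∃ d ∈ D, Near 2 (f d) (f k) := by
  by_contra! hfar
  obtain ⟨l, q, hq0, hql, hqD, hq⟩ := exists_path_of_isPreconnected hD f hf hd₀ hd₁
  have hfar' : ∀ k ∈ K, ∀ t ≤ l, ¬ Near 2 (q t) (f k) := by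
    intro k hk t ht
    obtain ⟨d, hd, e⟩ := hqD t ht
    exact e ▸ hfar k hk d hd
  -- If no values are near, the crossing number is locally constant along `K`, but it is 1 at `k₀`
  -- and 0 at `k₁`.
  have e := eq_of_isPreconnected hK (fun k => crossingNumber q l (f k)) (fun k hk => by
    filter_upwards [hf k] with k' hk' _
    exact crossingNumber_eq_of_near hq (hq0 ▸ h₂ k hk) (hql ▸ h₃ k hk) hk' (hfar' k hk)) hk₀ hk₁
  have e0 : crossingNumber q l (f k₀) = 1 := by
    refine crossingNumber_of_le hq (hq0 ▸ h₂ _ hk₀) (hql ▸ h₃ _ hk₀) (fun t ht => ?_) (hfar' _ hk₀)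
    obtain ⟨d, hd, e⟩ := hqD t ht
    exact e ▸ h₀ d hd
  have e1 : crossingNumber q l (f k₁) = 0 := by
    refine crossingNumber_of_ge fun t ht => ?_
    obtain ⟨d, hd, e⟩ := hqD t ht
    exact e ▸ h₁ d hd
  simp only [e0, e1] at e
  exact one_ne_zero e

end Connected

/-- In the square of a chainable continuum, two continua `K` and `D` intersect if the first
projection of `K` contains that of `D` and the second projection of `D` contains that of `K`. -/
theorem IsChainable.inter_nonempty {X : Type*} [MetricSpace X] [CompactSpace X]
    (hX : IsChainable X) {K D : Set (X × X)} (hK : IsSubcontinuum K) (hD : IsSubcontinuum D)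
    (h1 : Prod.fst '' D ⊆ Prod.fst '' K) (h2 : Prod.snd '' K ⊆ Prod.snd '' D) :
    (K ∩ D).Nonempty := by
  by_contra hne
  obtain ⟨δ, hδ, hdist⟩ : ∃ δ > 0, ∀ k ∈ K, ∀ d ∈ D, δ ≤ dist d k := by
    obtain ⟨p, ⟨hpD, hpK⟩, hp⟩ := (hD.1.prod hK.1).exists_isMinOn (hD.2.1.prod hK.2.1)
      (continuous_dist.continuousOn (s := D ×ˢ K))
    refine ⟨dist p.1 p.2, dist_pos.2 fun e => hne ⟨p.2, hpK, e ▸ hpD⟩, fun k hk d hd => ?_⟩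
    exact isMinOn_iff.1 hp (d, k) ⟨hd, hk⟩
  -- Indices differing by at most 2 are joined by three consecutive links, hence the third of `δ`.
  obtain ⟨n, U, hUo, hUc, hUn, hUd⟩ := hX (δ / 3) (by positivity)
  have hmem : ∀ x, ∃ j, x ∈ U j := fun x => mem_iUnion.1 (hUc ▸ mem_univ x)
  choose φ hφ using hmem
  let g : X → ℤ := fun x => ((φ x : ℕ) : ℤ)
  have hg : ∀ x, ∀ᶠ y in nhds x, |g x - g y| ≤ 1 := fun x => by
    filter_upwards [(hUo _).mem_nhds (hφ x)] with y hy
    exact (hUn _ _).1 ⟨y, hy, hφ y⟩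
  have hUlt : ∀ j, ∀ x ∈ U j, ∀ y ∈ U j, dist x y < δ / 3 := fun j x hx y hy =>
    (Metric.dist_le_diam_of_mem (Metric.isBounded_of_compactSpace) hx hy).trans_lt (hUd j)
  have hclose : ∀ x y, |g x - g y| ≤ 2 → dist x y < δ := by
    intro x y hxy
    obtain ⟨m, hm1, hm2⟩ : ∃ m : Fin n, |g x - ((m : ℕ) : ℤ)| ≤ 1 ∧ |((m : ℕ) : ℤ) - g y| ≤ 1 := by
      have hx := (φ x).2
      have hy := (φ y).2
      simp only [g, abs_le] at hxy ⊢
      by_cases c1 : (φ x : ℕ) < φ y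
      · exact ⟨⟨φ x + 1, by omega⟩, by push_cast; omega, by push_cast; omega⟩
      by_cases c2 : (φ y : ℕ) < φ x
      · exact ⟨⟨φ y + 1, by omega⟩, by push_cast; omega, by push_cast; omega⟩
      exact ⟨φ x, by omega, by omega⟩
    obtain ⟨z, hz1, hz2⟩ := (hUn _ _).2 hm1
    obtain ⟨w, hw1, hw2⟩ := (hUn _ _).2 hm2
    have a1 := hUlt _ x (hφ x) z hz1
    have a2 := hUlt _ z hz2 w hw1
    have a3 := hUlt _ w hw2 y (hφ y)
    linarith [dist_triangle4 x z w y]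
  have hfin : (range g).Finite := (finite_range fun j : Fin n => ((j : ℕ) : ℤ)).subset <| by
    rintro _ ⟨x, rfl⟩
    exact ⟨φ x, rfl⟩
  -- Finitely many indices occur, so extremes over `S` are attained, and points of `T` with the same
  -- projections attain them too.
  have hspan : ∀ {S T : Set (X × X)} (π : X × X → X), S.Nonempty → π '' S ⊆ π '' T →
      (∃ t ∈ T, ∀ s ∈ S, g (π t) ≤ g (π s)) ∧ ∃ t ∈ T, ∀ s ∈ S, g (π s) ≤ g (π t) := by
    intro S T π hS hST
    have hne : ((fun s => g (π s)) '' S).Nonempty := hS.image _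
    have hf : ((fun s => g (π s)) '' S).Finite := hfin.subset <| by
      rintro _ ⟨s, _, rfl⟩
      exact ⟨_, rfl⟩
    obtain ⟨_, ⟨s, hs, rfl⟩, hs'⟩ := hf.exists_minimal hne
    obtain ⟨_, ⟨u, hu, rfl⟩, hu'⟩ := hf.exists_maximal hne
    obtain ⟨t, ht, et⟩ := hST ⟨s, hs, rfl⟩
    obtain ⟨r, hr, er⟩ := hST ⟨u, hu, rfl⟩
    refine ⟨⟨t, ht, fun a ha => ?_⟩, r, hr, fun a ha => ?_⟩
    · rw [et]
      exact (le_total _ _).elim id fun h => hs' ⟨a, ha, rfl⟩ h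
    · rw [er]
      exact (le_total _ _).elim id fun h => hu' ⟨a, ha, rfl⟩ h
  obtain ⟨⟨k₀, hk₀, a₀⟩, k₁, hk₁, a₁⟩ := hspan Prod.fst hD.2.1 h1
  obtain ⟨⟨d₀, hd₀, b₀⟩, d₁, hd₁, b₁⟩ := hspan Prod.snd hK.2.1 h2
  obtain ⟨k, hk, d, hd, hn1, hn2⟩ := exists_near_of_spans hK.2.2 hD.2.2
    (fun z => (g z.1, g z.2)) (fun z => by
      filter_upwards [continuous_fst.continuousAt.eventually (hg z.1),
        continuous_snd.continuousAt.eventually (hg z.2)] with w h1 h2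
      exact ⟨h1, h2⟩)
    hk₀ hk₁ hd₀ hd₁ a₀ a₁ b₀ b₁
  have := hdist k hk d hd
  rw [Prod.dist_eq] at this
  exact absurd this (not_le.2 (max_lt (hclose _ _ hn1) (hclose _ _ hn2)))

/-! ### Boundary bumping and hereditary indecomposability -/

section Continua

variable {Z : Type*} [TopologicalSpace Z]

theorem isSubcontinuum_connectedComponentIn [T2Space Z] {F : Set Z} (hF : IsCompact F) {x : Z}
    (hx : x ∈ F) : IsSubcontinuum (connectedComponentIn F x) := by
  refine ⟨hF.of_isClosed_subset ?_ (connectedComponentIn_subset F x),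
    isConnected_connectedComponentIn_iff.2 hx⟩
  refine isClosed_of_closure_subset ?_
  refine IsPreconnected.subset_connectedComponentIn isPreconnected_connectedComponentIn.closure
    (subset_closure (mem_connectedComponentIn hx)) ?_
  exact closure_minimal (connectedComponentIn_subset F x) hF.isClosed

/-- An open set containing a component of a compact set `M` contains a neighbourhood of it that is
clopen relative to `M`. -/
theorem exists_clopen_of_connectedComponentIn_subset [T2Space Z] {M U : Set Z} (hM : IsCompact M)
    (hU : IsOpen U) {x : Z} (hx : x ∈ M) (h : connectedComponentIn M x ⊆ U) :
    ∃ V ⊆ U, x ∈ V ∧ V ⊆ M ∧ IsClosed V ∧ IsClosed (M \ V) := by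
  have := isCompact_iff_compactSpace.1 hM
  rw [connectedComponentIn_eq_image hx, image_subset_iff,
    connectedComponent_eq_iInter_isClopen] at h
  have : Nonempty {s : Set M // IsClopen s ∧ (⟨x, hx⟩ : M) ∈ s} := ⟨⟨univ, isClopen_univ, trivial⟩⟩
  obtain ⟨⟨s, hs, hxs⟩, hsU⟩ := exists_subset_nhds_of_isCompact
    (V := fun s : {s : Set M // IsClopen s ∧ (⟨x, hx⟩ : M) ∈ s} => (s : Set M))
    (fun a b => ⟨⟨a ∩ b, a.2.1.inter b.2.1, a.2.2, b.2.2⟩, inter_subset_left, inter_subset_right⟩)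
    (fun s => s.2.1.1.isCompact)
    (fun y hy => (hU.preimage continuous_subtype_val).mem_nhds (h hy))
  refine ⟨(↑) '' s, image_subset_iff.2 hsU, ⟨_, hxs, rfl⟩, by simp, ?_, ?_⟩
  · exact hM.isClosed.isClosedMap_subtype_val _ hs.1
  · have : M \ (↑) '' s = ((↑) : M → Z) '' sᶜ := by
      ext z
      constructor
      · rintro ⟨hz, hzs⟩
        exact ⟨⟨z, hz⟩, fun h => hzs ⟨_, h, rfl⟩, rfl⟩
      · rintro ⟨y, hy, rfl⟩
        refine ⟨y.2, ?_⟩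
        rintro ⟨y', hy', e⟩
        exact hy (Subtype.ext e ▸ hy')
    rw [this]
    exact hM.isClosed.isClosedMap_subtype_val _ hs.compl.1

/-- Boundary bumping. -/
theorem not_connectedComponentIn_subset [T2Space Z] {W U F : Set Z} (hW : IsSubcontinuum W)
    (hU : IsOpen U) (hF : IsClosed F) (hUF : U ⊆ F) (hWU : ¬ W ⊆ U) {x : Z} (hxW : x ∈ W)
    (hx : x ∈ F) : ¬ connectedComponentIn (W ∩ F) x ⊆ U := by
  -- A relatively clopen `V ⊆ U` around the component would split `W` into `V` and the closed set
  -- `(W ∩ F) \ V ∪ (W \ U)`.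
  intro h
  obtain ⟨V, hVU, hxV, hVM, hV, hMV⟩ :=
    exists_clopen_of_connectedComponentIn_subset (hW.1.inter_right hF) hU ⟨hxW, hx⟩ h
  obtain ⟨y, hyW, hyU⟩ := not_subset.1 hWU
  obtain ⟨z, -, hzV, hz⟩ := isPreconnected_closed_iff.1 hW.2.2 V ((W ∩ F) \ V ∪ (W \ U)) hV
    (hMV.union (hW.1.diff hU).isClosed) (fun z hz => by
      by_cases hzV : z ∈ V
      · exact .inl hzV
      by_cases hzU : z ∈ U
      · exact .inr (.inl ⟨⟨hz, hUF hzU⟩, hzV⟩)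
      · exact .inr (.inr ⟨hz, hzU⟩))
    ⟨x, hxW, hxV⟩ ⟨y, hyW, .inr ⟨hyW, hyU⟩⟩
  rcases hz with hz | hz
  · exact hz.2 hzV
  · exact hz.2 (hVU hzV)

/-- The intersection of a decreasing sequence of continua is a continuum. -/
theorem isSubcontinuum_iInter [T2Space Z] {K : ℕ → Set Z} (hK : ∀ n, IsSubcontinuum (K n))
    (hanti : Antitone K) : IsSubcontinuum (⋂ n, K n) := by
  have hc : IsCompact (⋂ n, K n) :=
    (hK 0).1.of_isClosed_subset (isClosed_iInter fun n => (hK n).1.isClosed) (iInter_subset _ _)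
  have hne : (⋂ n, K n).Nonempty :=
    IsCompact.nonempty_iInter_of_sequence_nonempty_isCompact_isClosed K
      (fun n => hanti n.le_succ) (fun n => (hK n).2.1) (hK 0).1 fun n => (hK n).1.isClosed
  refine ⟨hc, hne, isPreconnected_closed_iff.2 fun u v hu hv huv hLu hLv => ?_⟩
  by_contra hemp
  have hdisj : Disjoint ((⋂ n, K n) ∩ u) ((⋂ n, K n) ∩ v) := by
    rw [Set.disjoint_left]
    exact fun z hz hz' => hemp ⟨z, hz.1, hz.2, hz'.2⟩
  obtain ⟨O, P, hO, hP, huO, hvP, hOP⟩ :=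
    SeparatedNhds.of_isCompact_isCompact (hc.inter_right hu) (hc.inter_right hv) hdisj
  obtain ⟨n, hn⟩ := exists_subset_nhds_of_isCompact (V := K) (U := O ∪ P)
    (directed_of_isDirected_le hanti) (fun n => (hK n).1) fun z hz => by
      refine (hO.union hP).mem_nhds ?_
      rcases huv hz with h | h
      · exact .inl (huO ⟨hz, h⟩)
      · exact .inr (hvP ⟨hz, h⟩)
  obtain ⟨x, hx⟩ := hLu
  obtain ⟨y, hy⟩ := hLv
  obtain ⟨z, -, hz⟩ := (hK n).2.2 O P hO hP hn ⟨x, mem_iInter.1 hx.1 n, huO hx⟩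
    ⟨y, mem_iInter.1 hy.1 n, hvP hy⟩
  exact Set.disjoint_left.1 hOP hz.1 hz.2

theorem IsSubcontinuum.image {Y : Type*} [TopologicalSpace Y] {K : Set Z} (hK : IsSubcontinuum K)
    {f : Z → Y} (hf : Continuous f) : IsSubcontinuum (f '' K) :=
  ⟨hK.1.image hf, hK.2.image f hf.continuousOn⟩

theorem IsHereditarilyIndecomposable.subset_or_subset (hZ : IsHereditarilyIndecomposable Z)
    {H L : Set Z} (hH : IsSubcontinuum H) (hL : IsSubcontinuum L) (hHL : (H ∩ L).Nonempty) :
    H ⊆ L ∨ L ⊆ H := by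
  by_contra! h
  refine hZ (H ∪ L) ⟨hH.1.union hL.1, hH.2.union hHL hL.2⟩ ⟨H, L, hH, hL, ?_, ?_, rfl⟩
  · exact ⟨subset_union_left, fun h' => h.2 (subset_union_right.trans h')⟩
  · exact ⟨subset_union_right, fun h' => h.1 (subset_union_left.trans h')⟩

theorem IsHereditarilyIndecomposable.eq_univ_of_nonempty_interior [T2Space Z] [CompactSpace Z]
    [ConnectedSpace Z] (hZ : IsHereditarilyIndecomposable Z) {H : Set Z} (hH : IsSubcontinuum H)
    (hint : (interior H).Nonempty) : H = univ := by
  by_contra hne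
  obtain ⟨x, hx⟩ := (ne_univ_iff_exists_notMem H).1 hne
  obtain ⟨y, hy⟩ := hint
  have hxF : x ∈ (interior H)ᶜ := fun h => hx (interior_subset h)
  have hF : IsClosed (interior H)ᶜ := isOpen_interior.isClosed_compl
  have hcomp : IsSubcontinuum (connectedComponentIn (univ ∩ (interior H)ᶜ) x) :=
    isSubcontinuum_connectedComponentIn (isCompact_univ.inter_right hF) ⟨trivial, hxF⟩
  -- The component of `x` off the interior of `H` reaches `H`; neither contains the other.
  have hbump := not_connectedComponentIn_subset (W := univ)
    ⟨isCompact_univ, isConnected_univ⟩ hH.1.isClosed.isOpen_compl hF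
    (compl_subset_compl.2 interior_subset)
    (fun h => h (mem_univ y) (interior_subset hy)) (mem_univ x) hxF
  obtain ⟨z, hz, hzH⟩ := not_subset.1 hbump
  rcases hZ.subset_or_subset hH hcomp ⟨z, not_not.1 hzH, hz⟩ with h | h
  · exact (connectedComponentIn_subset _ _ (h (interior_subset hy))).2 hy
  · exact hx (h (mem_connectedComponentIn ⟨trivial, hxF⟩))

end Continua

/-! ### Continua meeting a product of continua -/

variable {X : Type*} [MetricSpace X]

/-- A continuum in the square of a hereditarily indecomposable space that meets the product `A × B`
of two continua without being contained in it contains a subcontinuum of `A × B` through any given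
common point that projects onto one of the factors. -/
theorem IsHereditarilyIndecomposable.exists_subcontinuum_prod
    (hX : IsHereditarilyIndecomposable X) {A B : Set X} (hA : IsSubcontinuum A)
    (hB : IsSubcontinuum B) {W : Set (X × X)} (hW : IsSubcontinuum W) (hWAB : ¬ W ⊆ A ×ˢ B)
    {p : X × X} (hpW : p ∈ W) (hp : p ∈ A ×ˢ B) :
    ∃ K ⊆ W ∩ A ×ˢ B, IsSubcontinuum K ∧ (A ⊆ Prod.fst '' K ∨ B ⊆ Prod.snd '' K) := by
  obtain ⟨w, hwW, hw⟩ := not_subset.1 hWAB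
  have hAB : IsClosed (A ×ˢ B) := hA.1.isClosed.prod hB.1.isClosed
  set S := A ×ˢ B with hS
  have hSne : S.Nonempty := ⟨p, hp⟩
  obtain ⟨u, hu, hu0, hulim⟩ : ∃ u : ℕ → ℝ, StrictAnti u ∧
      (∀ n, u n ∈ Ioo 0 (Metric.infDist w S)) ∧ Filter.Tendsto u Filter.atTop (nhds 0) :=
    exists_seq_strictAnti_tendsto' ((hAB.notMem_iff_infDist_pos hSne).1 hw)
  -- Shrinking closed neighbourhoods of `S`, all omitting `w`. By bumping, each component `K n`
  -- leaves `S`, so its projections cannot lie in both `A` and `B`; nestedness makes one of them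
  -- cover its factor.
  let F : ℕ → Set (X × X) := fun n => {z | Metric.infDist z S ≤ u n}
  have hF : ∀ n, IsClosed (F n) := fun n =>
    isClosed_le (Metric.continuous_infDist_pt S) continuous_const
  have hpF : ∀ n, p ∈ F n := fun n => by
    simpa [F, Metric.infDist_zero_of_mem hp] using (hu0 n).1.le
  let K : ℕ → Set (X × X) := fun n => connectedComponentIn (W ∩ F n) p
  have hK : ∀ n, IsSubcontinuum (K n) := fun n =>
    isSubcontinuum_connectedComponentIn (hW.1.inter_right (hF n)) ⟨hpW, hpF n⟩
  have hpK : ∀ n, p ∈ K n := fun n => mem_connectedComponentIn ⟨hpW, hpF n⟩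
  have hanti : Antitone K := fun m n hmn => connectedComponentIn_mono _ <|
    inter_subset_inter_right _ fun z (hz : _ ≤ _) => hz.trans (hu.antitone hmn)
  have hor : ∀ n, A ⊆ Prod.fst '' K n ∨ B ⊆ Prod.snd '' K n := by
    intro n
    have hbump := not_connectedComponentIn_subset (U := {z | Metric.infDist z S < u n}) hW
      (isOpen_lt (Metric.continuous_infDist_pt S) continuous_const) (hF n)
      (ofPred_subset_ofPred.2 fun _ hz => hz.le) (fun h => (h hwW).not_gt (hu0 n).2) hpW (hpF n)
    by_contra! h
    have h1 := (hX.subset_or_subset hA ((hK n).image continuous_fst)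
      ⟨p.1, hp.1, p, hpK n, rfl⟩).resolve_left h.1
    have h2 := (hX.subset_or_subset hB ((hK n).image continuous_snd)
      ⟨p.2, hp.2, p, hpK n, rfl⟩).resolve_left h.2
    refine hbump fun z hz => ?_
    have hzS : z ∈ S := ⟨h1 ⟨z, hz, rfl⟩, h2 ⟨z, hz, rfl⟩⟩
    simpa [Metric.infDist_zero_of_mem hzS] using (hu0 n).1
  have hproj : ∀ (π : X × X → X) (T : Set X), Continuous π → (∀ n, T ⊆ π '' K n) →
      T ⊆ π '' ⋂ n, K n := by
    intro π T hπ hT x hx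
    have hfib : IsClosed (π ⁻¹' {x}) := isClosed_singleton.preimage hπ
    obtain ⟨z, hz⟩ := IsCompact.nonempty_iInter_of_sequence_nonempty_isCompact_isClosed
      (fun n => K n ∩ π ⁻¹' {x}) (fun n => inter_subset_inter_left _ (hanti n.le_succ))
      (fun n => by
        obtain ⟨z, hz, e⟩ := hT n hx
        exact ⟨z, hz, e⟩)
      ((hK 0).1.inter_right hfib) fun n => (hK n).1.isClosed.inter hfib
    rw [mem_iInter] at hz
    exact ⟨z, mem_iInter.2 fun n => (hz n).1, (hz 0).2⟩
  refine ⟨⋂ n, K n, fun z hz => ?_, isSubcontinuum_iInter hK hanti, ?_⟩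
  · have hzn : ∀ n, z ∈ W ∩ F n := fun n => connectedComponentIn_subset _ _ (mem_iInter.1 hz n)
    refine ⟨(hzn 0).1, (hAB.mem_iff_infDist_zero hSne).2 (le_antisymm ?_ Metric.infDist_nonneg)⟩
    exact ge_of_tendsto' hulim fun n => (hzn n).2
  -- Since `K` decreases, once the first alternative fails it fails from then on, so the second
  -- holds for all large `n`, hence for all `n`.
  · by_cases h : ∀ n, A ⊆ Prod.fst '' K n
    · exact .inl (hproj _ _ continuous_fst h)
    · right
      push Not at h
      obtain ⟨m, hm⟩ := h
      refine hproj _ _ continuous_snd fun n => ?_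
      have := (hor (max m n)).resolve_left fun h' =>
        hm (h'.trans (image_mono (hanti (le_max_left m n))))
      exact this.trans (image_mono (hanti (le_max_right m n)))

end ContinuumTheory

open ContinuumTheory

theorem theorem4p4 {X : Type*} [MetricSpace X] (hX : ContinuumTheory.IsPseudoArc X)
    (C : Set (X × X)) (hC : ContinuumTheory.IsSubcontinuum C)
    (hT : ContinuumTheory.IsTClosed C) :
    C = Set.univ ∨
      ∃ A B : Set X, ContinuumTheory.IsProperSubcontinuum A ∧
        ContinuumTheory.IsProperSubcontinuum B ∧ C = A ×ˢ B := by
  have := hX.compact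
  have := hX.connected
  have hHI := hX.hereditarilyIndecomposable
  have hW : ∀ z ∉ C, ∃ W : Set (X × X), IsSubcontinuum W ∧ z ∈ interior W ∧ W ⊆ Cᶜ := by
    intro z hz
    rw [← hT.2.2] at hz
    exact not_not.1 hz
  -- Projections are open maps, so the image continua have interior and are therefore everything.
  have hfull : ∀ {W : Set (X × X)} {z : X × X}, IsSubcontinuum W → z ∈ interior W →
      Prod.fst '' W = Set.univ ∧ Prod.snd '' W = Set.univ := by
    intro W z hW hz
    have h1 : z.1 ∈ interior (Prod.fst '' W) :=
      interior_maximal (Set.image_mono interior_subset) (isOpenMap_fst _ isOpen_interior)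
        ⟨z, hz, rfl⟩
    have h2 : z.2 ∈ interior (Prod.snd '' W) :=
      interior_maximal (Set.image_mono interior_subset) (isOpenMap_snd _ isOpen_interior)
        ⟨z, hz, rfl⟩
    exact ⟨hHI.eq_univ_of_nonempty_interior (hW.image continuous_fst) ⟨_, h1⟩,
      hHI.eq_univ_of_nonempty_interior (hW.image continuous_snd) ⟨_, h2⟩⟩
  refine or_iff_not_imp_left.2 fun hne => ?_
  have hA := hC.image continuous_fst
  have hB := hC.image continuous_snd
  obtain ⟨z, hz⟩ := (Set.ne_univ_iff_exists_notMem C).1 hne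
  obtain ⟨V, hV, hzV, hVC⟩ := hW z hz
  obtain ⟨hV1, hV2⟩ := hfull hV hzV
  have hA' : Prod.fst '' C ≠ Set.univ := fun h => by
    obtain ⟨y, hyC, hyV⟩ := hX.chainable.inter_nonempty hC hV (by simp [h]) (by simp [hV2])
    exact hVC hyV hyC
  have hB' : Prod.snd '' C ≠ Set.univ := fun h => by
    obtain ⟨y, hyV, hyC⟩ := hX.chainable.inter_nonempty hV hC (by simp [hV1]) (by simp [h])
    exact hVC hyV hyC
  refine ⟨_, _, ⟨hA, hA'⟩, ⟨hB, hB'⟩, Set.Subset.antisymm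
    (fun p hp => ⟨⟨p, hp, rfl⟩, ⟨p, hp, rfl⟩⟩) fun p hp => ?_⟩
  by_contra hpC
  obtain ⟨W, hWc, hpW, hWC⟩ := hW p hpC
  have hWAB : ¬ W ⊆ (Prod.fst '' C) ×ˢ (Prod.snd '' C) := fun h => hA' <| by
    rw [Set.eq_univ_iff_forall]
    intro x
    obtain ⟨w, hw, rfl⟩ := (hfull hWc hpW).1.symm ▸ Set.mem_univ x
    exact (h hw).1
  -- `K` spans `C` in one direction and, lying in the product of the projections of `C`, is spanned
  -- by `C` in the other.
  obtain ⟨K, hKsub, hK, h | h⟩ :=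
    hHI.exists_subcontinuum_prod hA hB hWc hWAB (interior_subset hpW) hp
  · obtain ⟨y, hyK, hyC⟩ := hX.chainable.inter_nonempty hK hC h
      (Set.image_subset_iff.2 fun k hk => (hKsub hk).2.2)
    exact hWC (hKsub hyK).1 hyC
  · obtain ⟨y, hyC, hyK⟩ := hX.chainable.inter_nonempty hC hK
      (Set.image_subset_iff.2 fun k hk => (hKsub hk).2.1) h
    exact hWC (hKsub hyK).1 hyC
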